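/- Let $n\in\mathbb{N}$, $T>0$, and let $\kappa,R,m:\mathbb{R}\to\mathbb{R}^{n\times n}$ be continuous and $T$-periodic, with $\kappa(t)$ and $m(t)$ symmetric and $m(t)$ invertible for every $t$. Put $$J=\begin{pmatrix}0&I_n\\-I_n&0\end{pmatrix},\qquad A(t)=\begin{pmatrix}\kappa(t)&R(t)\\R(t)^{\top}&m(t)^{-1}\end{pmatrix}.$$ The linear Hamiltonian system $\dot z=JA(t)z$ on $\mathbb{R}^{2n}$ is called stable if each of its solutions $z$ (that is, the solution for every initial value $z(0)\in\mathbb{R}^{2n}$) is bounded on $[0,\infty)$. Then the system is stable if and only if there is a differentiable function $w:\mathbb{R}\to\mathbb{R}^{n\times n}$ with $w(t)$ invertible for every $t$ such that (i) $\dot w m-wRm$ is differentiable and $w$ satisfies the envelope equation $$\frac{d}{dt}\left(\dot w m-wRm\right)+\dot w mR^{\top}+w\left(\kappa-RmR^{\top}\right)-\left(w^{\top}w\,m\,w^{\top}\right)^{-1}=0\quad\text{on }\mathbb{R};$$ (ii) the matrix $S_0=S(0)$ is symplectic (i.e. $S_0JS_0^{\top}=J$), where $$S(t)=\begin{pmatrix}(w^{\top})^{-1}&0\\(wR-\dot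 w)m&w\end{pmatrix};$$ (iii) $|w|=\sqrt{w^{\top}w}$ (the positive semidefinite square root) is $T$-periodic, i.e. $|w(t+T)|=|w(t)|$ for all $t\in\mathbb{R}$. -/

import Mathlib

namespace LinHam

open scoped MatrixOrder

/-- Real `n × n` matrices. -/
abbrev Mat (n : ℕ) := Matrix (Fin n) (Fin n) ℝ

/-- The phase space `ℝ^{2n}`, with coordinates `z = (x, p)`. -/
abbrev Phase (n : ℕ) := Fin n ⊕ Fin n → ℝ

/-- The standard symplectic matrix `[[0, I], [-I, 0]]` (the negative of `Matrix.J`). -/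
def stdJ (n : ℕ) : Matrix (Fin n ⊕ Fin n) (Fin n ⊕ Fin n) ℝ :=
  Matrix.fromBlocks 0 1 (-1) 0

/-- The matrix `A = [[κ, R], [Rᵀ, m⁻¹]]` of the quadratic Hamiltonian `H = (1/2) zᵀ A z`. -/
noncomputable def hamMatrix {n : ℕ} (κ R m : Mat n) :
    Matrix (Fin n ⊕ Fin n) (Fin n ⊕ Fin n) ℝ :=
  Matrix.fromBlocks κ R R.transpose m⁻¹

/-- `z` solves the linear Hamiltonian system `ż = J A(t) z`. -/
def IsHamSolution {n : ℕ} (κ R m : ℝ → Mat n) (z : ℝ → Phase n) : Prop :=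
  ∀ t, HasDerivAt z ((stdJ n * hamMatrix (κ t) (R t) (m t)).mulVec (z t)) t

/-- Stability: every solution, whatever its value at time `0`, stays bounded as `t → ∞`. -/
def IsStable {n : ℕ} (κ R m : ℝ → Mat n) : Prop :=
  ∀ z : ℝ → Phase n, IsHamSolution κ R m z → ∃ C : ℝ, ∀ t, 0 ≤ t → ‖z t‖ ≤ C

/-- `w` is a (global, classical) solution of the envelope equation
`d/dt (ẇ m - w R m) + ẇ m Rᵀ + w (κ - R m Rᵀ) - (wᵀ w m wᵀ)⁻¹ = 0`.
Since `⁻¹` of a singular matrix is a junk value, invertibility of `w t` is spelled out; likewise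
the existence of the two derivatives that occur. -/
def IsEnvelopeSolution {n : ℕ} (κ R m w : ℝ → Mat n) : Prop :=
  (∀ t, IsUnit (w t).det) ∧
  Differentiable ℝ w ∧
  Differentiable ℝ (fun s => deriv w s * m s - w s * R s * m s) ∧
  ∀ t, deriv (fun s => deriv w s * m s - w s * R s * m s) t
      + deriv w t * m t * (R t).transpose
      + w t * (κ t - R t * m t * (R t).transpose)
      - ((w t).transpose * w t * m t * (w t).transpose)⁻¹ = 0

/-- The matrix `S(t) = [[(wᵀ)⁻¹, 0], [(w R - ẇ) m, w]]`. -/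
noncomputable def envelopeS {n : ℕ} (R m w : ℝ → Mat n) (t : ℝ) :
    Matrix (Fin n ⊕ Fin n) (Fin n ⊕ Fin n) ℝ :=
  Matrix.fromBlocks ((w t).transpose)⁻¹ 0 ((w t * R t - deriv w t) * m t) (w t)

/-- `|w| = √(wᵀ w)`, the positive semidefinite square root. -/
noncomputable def matAbs {n : ℕ} (w : Mat n) : Mat n :=
  CFC.sqrt (w.transpose * w)

end LinHam

/-!
The positive definite symplectic matrices are the `F = (Sᵀ S)⁻¹` with
`S = [[(wᵀ)⁻¹, 0], [-w s, w]]`, `w` invertible and `s` symmetric. In these coordinates the Lyapunov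
equation `Ḟ = B F + F Bᵀ`, `B = J A`, becomes the envelope equation for `w`, where
`s = w⁻¹ (ẇ m - w R m)`; the upper left block of `F` is `wᵀ w = |w|²`.

If the system is stable, the powers of its monodromy matrix `M` are bounded, and so are their
inverses since `M` is symplectic. Averaging `(Mᵏ)ᵀ Mᵏ` gives a positive definite `P` with
`Mᵀ P M = P`. The positive definite solution `X` of `X P X = J P Jᵀ` (the geometric mean of `P⁻¹`
and `J P Jᵀ`) is unique, hence symplectic with `M X Mᵀ = X`. Transporting `X` by the flow produces
a periodic `F`, and `w` is recovered from `wᵀ w`.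

Conversely, `F` transported by the flow gives `zᵢ² ≤ C Fᵢᵢ` along a solution `z = (x, p)`, so
periodicity of `|w|` bounds the positions `x`. As `m⁻¹` is invertible, the positions over one period
control the momenta, uniformly in the period by periodicity of the system.
-/

namespace LinHam

open Matrix Topology
open scoped MatrixOrder NNReal

section LinearODE

theorem exists_norm_le_on_Ioo {F : Type*} [SeminormedAddGroup F] {f : ℝ → F} (hf : Continuous f)
    (a b : ℝ) : ∃ K : ℝ≥0, ∀ t ∈ Set.Ioo a b, ‖f t‖ ≤ K := by
  obtain ⟨K, hK⟩ := isCompact_Icc.exists_bound_of_continuousOn (s := Set.Icc a b) hf.continuousOn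
  exact ⟨K.toNNReal, fun t ht => (hK t (Set.Ioo_subset_Icc_self ht)).trans K.le_coe_toNNReal⟩

variable {E : Type*} [NormedAddCommGroup E] [NormedSpace ℝ E]

theorem eq_of_hasDerivAt_clm_apply {B : ℝ → E →L[ℝ] E} (hB : Continuous B) {x y : ℝ → E}
    (hx : ∀ t, HasDerivAt x (B t (x t)) t) (hy : ∀ t, HasDerivAt y (B t (y t)) t) {t₀ : ℝ}
    (h₀ : x t₀ = y t₀) : x = y := by
  funext t
  have hmem : ∀ s, |s| ≤ |t₀| + |t| → s ∈ Set.Ioo (-(|t₀| + |t| + 1)) (|t₀| + |t| + 1) :=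
    fun s hs => abs_lt.1 (by linarith)
  obtain ⟨K, hK⟩ := exists_norm_le_on_Ioo hB (-(|t₀| + |t| + 1)) (|t₀| + |t| + 1)
  exact ODE_solution_unique_of_mem_Ioo (v := fun s => B s) (s := fun _ => Set.univ)
    (fun s hs => ((B s).lipschitz.weaken (hK s hs)).lipschitzOnWith)
    (hmem t₀ (by linarith [abs_nonneg t])) (fun s _ => ⟨hx s, trivial⟩)
    (fun s _ => ⟨hy s, trivial⟩) h₀ (hmem t (by linarith [abs_nonneg t₀]))

/-- The terms of the Peano–Baker series, whose sum is the solution of `ẋ = B x`, `x 0 = x₀`. -/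
noncomputable def peanoBakerTerm (B : ℝ → E →L[ℝ] E) (x₀ : E) : ℕ → ℝ → E
  | 0 => fun _ => x₀
  | k + 1 => fun t => ∫ s in (0 : ℝ)..t, B s (peanoBakerTerm B x₀ k s)

theorem peanoBakerTerm_succ_zero (B : ℝ → E →L[ℝ] E) (x₀ : E) (k : ℕ) :
    peanoBakerTerm B x₀ (k + 1) 0 = 0 :=
  intervalIntegral.integral_same

theorem continuous_peanoBakerTerm {B : ℝ → E →L[ℝ] E} (hB : Continuous B) (x₀ : E) (k : ℕ) :
    Continuous (peanoBakerTerm B x₀ k) := by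
  induction k with
  | zero => exact continuous_const
  | succ k ih =>
    exact intervalIntegral.continuous_primitive
      (fun a b => (hB.clm_apply ih).intervalIntegrable a b) 0

theorem norm_peanoBakerTerm_le {B : ℝ → E →L[ℝ] E} (hB : Continuous B) (x₀ : E) {a : ℝ} {K : ℝ≥0}
    (hK : ∀ t ∈ Set.Ioo (-a) a, ‖B t‖ ≤ K) (k : ℕ) {t : ℝ} (ht : t ∈ Set.Ioo (-a) a) :
    ‖peanoBakerTerm B x₀ k t‖ ≤ (K * |t|) ^ k / k.factorial * ‖x₀‖ := by
  induction k generalizing t with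
  | zero => simp [peanoBakerTerm]
  | succ k ih =>
    have hc := hB.clm_apply (continuous_peanoBakerTerm hB x₀ k)
    have hsub : Set.uIoc 0 t ⊆ Set.Ioo (-a) a := fun s hs => by
      obtain ⟨h1, h2⟩ := ht
      rcases Set.mem_uIoc.1 hs with h | h <;> constructor <;> linarith [h.1, h.2]
    have hg : Continuous fun s : ℝ => K ^ (k + 1) / k.factorial * ‖x₀‖ * |s - 0| ^ k := by
      fun_prop
    calc ‖peanoBakerTerm B x₀ (k + 1) t‖
        ≤ ∫ s in Set.uIoc 0 t, ‖B s (peanoBakerTerm B x₀ k s)‖ :=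
          intervalIntegral.norm_integral_le_integral_norm_uIoc
      _ ≤ ∫ s in Set.uIoc 0 t, K ^ (k + 1) / k.factorial * ‖x₀‖ * |s - 0| ^ k := by
          refine MeasureTheory.setIntegral_mono_on
            (hc.norm.intervalIntegrable 0 t).def' (hg.intervalIntegrable 0 t).def'
            measurableSet_uIoc fun s hs => ?_
          calc ‖B s (peanoBakerTerm B x₀ k s)‖ ≤ ‖B s‖ * ‖peanoBakerTerm B x₀ k s‖ :=
                (B s).le_opNorm _
            _ ≤ K * ((K * |s|) ^ k / k.factorial * ‖x₀‖) := by
                gcongr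
                exacts [hK s (hsub hs), ih (hsub hs)]
            _ = _ := by rw [sub_zero, mul_pow]; ring
      _ = (K * |t|) ^ (k + 1) / (k + 1).factorial * ‖x₀‖ := by
          rw [MeasureTheory.integral_const_mul, integral_pow_abs_sub_uIoc, sub_zero,
            Nat.factorial_succ, mul_pow]
          push_cast
          field_simp

theorem norm_apply_peanoBakerTerm_le {B : ℝ → E →L[ℝ] E} (hB : Continuous B) (x₀ : E) {a : ℝ}
    {K : ℝ≥0} (hK : ∀ t ∈ Set.Ioo (-a) a, ‖B t‖ ≤ K) (k : ℕ) {t : ℝ} (ht : t ∈ Set.Ioo (-a) a) :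
    ‖B t (peanoBakerTerm B x₀ k t)‖ ≤ K * ((K * a) ^ k / k.factorial * ‖x₀‖) :=
  calc ‖B t (peanoBakerTerm B x₀ k t)‖ ≤ ‖B t‖ * ‖peanoBakerTerm B x₀ k t‖ := (B t).le_opNorm _
    _ ≤ K * ((K * |t|) ^ k / k.factorial * ‖x₀‖) := by
        gcongr
        exacts [hK t ht, norm_peanoBakerTerm_le hB x₀ hK k ht]
    _ ≤ K * ((K * a) ^ k / k.factorial * ‖x₀‖) := by
        gcongr
        exact (abs_lt.2 ht).le

variable [CompleteSpace E]

theorem summable_peanoBakerTerm {B : ℝ → E →L[ℝ] E} (hB : Continuous B) (x₀ : E) (t : ℝ) :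
    Summable fun k => peanoBakerTerm B x₀ k t := by
  obtain ⟨K, hK⟩ := exists_norm_le_on_Ioo hB (-(|t| + 1)) (|t| + 1)
  exact Summable.of_norm_bounded ((Real.summable_pow_div_factorial (K * |t|)).mul_right ‖x₀‖)
    fun k => norm_peanoBakerTerm_le hB x₀ hK k (abs_lt.1 (lt_add_one |t|))

theorem hasDerivAt_peanoBakerTerm_succ {B : ℝ → E →L[ℝ] E} (hB : Continuous B) (x₀ : E) (k : ℕ)
    (t : ℝ) : HasDerivAt (peanoBakerTerm B x₀ (k + 1)) (B t (peanoBakerTerm B x₀ k t)) t := by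
  have hc := hB.clm_apply (continuous_peanoBakerTerm hB x₀ k)
  exact intervalIntegral.integral_hasDerivAt_right (hc.intervalIntegrable _ _)
    (hc.stronglyMeasurableAtFilter _ _) hc.continuousAt

theorem hasDerivAt_tsum_peanoBakerTerm_succ {B : ℝ → E →L[ℝ] E} (hB : Continuous B) (x₀ : E)
    (t : ℝ) : HasDerivAt (fun s => ∑' k, peanoBakerTerm B x₀ (k + 1) s)
      (∑' k, B t (peanoBakerTerm B x₀ k t)) t := by
  obtain ⟨K, hK⟩ := exists_norm_le_on_Ioo hB (-(|t| + 1)) (|t| + 1)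
  refine hasDerivAt_tsum_of_isPreconnected (y₀ := 0)
    (((Real.summable_pow_div_factorial (K * (|t| + 1))).mul_right ‖x₀‖).mul_left (K : ℝ))
    isOpen_Ioo isPreconnected_Ioo (fun k s _ => hasDerivAt_peanoBakerTerm_succ hB x₀ k s)
    (fun k s hs => norm_apply_peanoBakerTerm_le hB x₀ hK k hs) ?_ ?_
    (abs_lt.1 (lt_add_one |t|))
  · exact abs_lt.1 (by rw [abs_zero]; positivity)
  · simp only [peanoBakerTerm_succ_zero, summable_zero]

theorem exists_hasDerivAt_clm_apply {B : ℝ → E →L[ℝ] E} (hB : Continuous B) (x₀ : E) :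
    ∃ x : ℝ → E, x 0 = x₀ ∧ ∀ t, HasDerivAt x (B t (x t)) t := by
  have htail : ∀ t, ∑' k, peanoBakerTerm B x₀ k t = x₀ + ∑' k, peanoBakerTerm B x₀ (k + 1) t :=
    fun t => (summable_peanoBakerTerm hB x₀ t).tsum_eq_zero_add
  refine ⟨fun t => ∑' k, peanoBakerTerm B x₀ k t, ?_, fun t => ?_⟩
  · simp only [htail, peanoBakerTerm_succ_zero, tsum_zero, add_zero]
  · rw [(B t).map_tsum (summable_peanoBakerTerm hB x₀ t), funext htail]
    exact (hasDerivAt_tsum_peanoBakerTerm_succ hB x₀ t).const_add x₀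

end LinearODE

section MatrixCalculus

variable {𝕜 : Type*} [NontriviallyNormedField 𝕜] {ι ι' ι'' : Type*} {t : 𝕜}

theorem hasDerivAt_matrix_iff [Finite ι] [Finite ι'] {f : 𝕜 → Matrix ι ι' 𝕜} {f' : Matrix ι ι' 𝕜} :
    HasDerivAt f f' t ↔ ∀ i j, HasDerivAt (fun s => f s i j) (f' i j) t := by
  have := Fintype.ofFinite ι
  have := Fintype.ofFinite ι'
  exact (hasDerivAt_pi (φ := f) (φ' := f')).trans (forall_congr' fun i => hasDerivAt_pi)

theorem deriv_matrix_eq [Finite ι] [Finite ι'] {f : 𝕜 → Matrix ι ι' 𝕜} {f' : Matrix ι ι' 𝕜}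
    (hf : HasDerivAt f f' t) : deriv f t = f' := by
  have := Fintype.ofFinite ι
  have := Fintype.ofFinite ι'
  open scoped Matrix.Norms.Operator in exact hf.deriv

theorem hasDerivAt_matrix_deriv [Finite ι] [Finite ι'] {f : 𝕜 → Matrix ι ι' 𝕜}
    (hf : DifferentiableAt 𝕜 f t) : HasDerivAt f (deriv f t) t := by
  have := Fintype.ofFinite ι
  have := Fintype.ofFinite ι'
  open scoped Matrix.Norms.Operator in exact hf.hasDerivAt

theorem hasDerivAt_matrix_transpose [Finite ι] [Finite ι'] {f : 𝕜 → Matrix ι ι' 𝕜}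
    {f' : Matrix ι ι' 𝕜} (hf : HasDerivAt f f' t) : HasDerivAt (fun s => (f s)ᵀ) f'ᵀ t := by
  rw [hasDerivAt_matrix_iff] at *
  exact fun i j => hf j i

theorem hasDerivAt_fromBlocks_iff [Finite ι] {A B C D : 𝕜 → Matrix ι ι 𝕜}
    {A' B' C' D' : Matrix ι ι 𝕜} :
    HasDerivAt (fun s => fromBlocks (A s) (B s) (C s) (D s)) (fromBlocks A' B' C' D') t ↔
      HasDerivAt A A' t ∧ HasDerivAt B B' t ∧ HasDerivAt C C' t ∧ HasDerivAt D D' t := by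
  simp only [hasDerivAt_matrix_iff, Sum.forall, fromBlocks_apply₁₁, fromBlocks_apply₁₂,
    fromBlocks_apply₂₁, fromBlocks_apply₂₂, forall_and, and_assoc]
  exact and_congr_right fun _ => and_left_comm

theorem hasDerivAt_matrix_mul [Finite ι] [Fintype ι'] [Finite ι''] {f : 𝕜 → Matrix ι ι' 𝕜}
    {g : 𝕜 → Matrix ι' ι'' 𝕜} {f' : Matrix ι ι' 𝕜} {g' : Matrix ι' ι'' 𝕜}
    (hf : HasDerivAt f f' t) (hg : HasDerivAt g g' t) :
    HasDerivAt (fun s => f s * g s) (f' * g t + f t * g') t := by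
  rw [hasDerivAt_matrix_iff] at *
  intro i j
  simp only [Matrix.mul_apply, Matrix.add_apply, ← Finset.sum_add_distrib]
  exact HasDerivAt.fun_sum fun k _ => (hf i k).mul (hg k j)

theorem hasDerivAt_dotProduct [Fintype ι] {u v : 𝕜 → ι → 𝕜} {u' v' : ι → 𝕜}
    (hu : HasDerivAt u u' t) (hv : HasDerivAt v v' t) :
    HasDerivAt (fun s => u s ⬝ᵥ v s) (u' ⬝ᵥ v t + u t ⬝ᵥ v') t := by
  rw [hasDerivAt_pi] at *
  simp only [dotProduct, ← Finset.sum_add_distrib]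
  exact HasDerivAt.fun_sum fun k _ => (hu k).mul (hv k)

theorem hasDerivAt_mulVec [Finite ι] [Fintype ι'] {f : 𝕜 → Matrix ι ι' 𝕜} {v : 𝕜 → ι' → 𝕜}
    {f' : Matrix ι ι' 𝕜} {v' : ι' → 𝕜} (hf : HasDerivAt f f' t) (hv : HasDerivAt v v' t) :
    HasDerivAt (fun s => f s *ᵥ v s) (f' *ᵥ v t + f t *ᵥ v') t := by
  have := Fintype.ofFinite ι
  rw [hasDerivAt_matrix_iff] at hf
  exact hasDerivAt_pi.2 fun i => hasDerivAt_dotProduct (hasDerivAt_pi.2 (hf i)) hv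

open scoped Matrix.Norms.Operator in
theorem hasDerivAt_matrix_inv [Fintype ι] [DecidableEq ι] {f : ℝ → Matrix ι ι ℝ}
    {f' : Matrix ι ι ℝ} {t : ℝ} (hf : HasDerivAt f f' t) (hu : IsUnit (f t).det) :
    HasDerivAt (fun s => (f s)⁻¹) (-((f t)⁻¹ * f' * (f t)⁻¹)) t := by
  obtain ⟨u, hu⟩ := (Matrix.isUnit_iff_isUnit_det _).2 hu
  have h := (hu ▸ hasFDerivAt_ringInverse (𝕜 := ℝ) u : HasFDerivAt _ _ (f t)).comp_hasDerivAt t hf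
  have hval : -(ContinuousLinearMap.mulLeftRight ℝ (Matrix ι ι ℝ)) ↑u⁻¹ ↑u⁻¹ f' =
      -((f t)⁻¹ * f' * (f t)⁻¹) := by
    simp [← hu, mul_assoc]
  simp only [Function.comp_def, ← Matrix.nonsing_inv_eq_ringInverse] at h
  exact hval ▸ h

theorem continuous_matrix_inv {X : Type*} [TopologicalSpace X] [Fintype ι] [DecidableEq ι]
    {f : X → Matrix ι ι ℝ} (hf : Continuous f) (hu : ∀ x, IsUnit (f x).det) :
    Continuous fun x => (f x)⁻¹ := by
  simp only [inv_def, Ring.inverse_eq_inv']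
  exact (hf.matrix_det.inv₀ fun x => (hu x).ne_zero).smul hf.matrix_adjugate

end MatrixCalculus

section MatrixODE

variable {ι : Type*} [Fintype ι]

open scoped Matrix.Norms.Operator in
theorem exists_hasDerivAt_matrix_mul {B : ℝ → Matrix ι ι ℝ} (hB : Continuous B)
    (X₀ : Matrix ι ι ℝ) : ∃ X : ℝ → Matrix ι ι ℝ, X 0 = X₀ ∧ ∀ t, HasDerivAt X (B t * X t) t :=
  exists_hasDerivAt_clm_apply (B := fun t => ContinuousLinearMap.mul ℝ (Matrix ι ι ℝ) (B t))
    (by fun_prop) X₀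

open scoped Matrix.Norms.Operator in
theorem eq_of_hasDerivAt_matrix_mul_add_mul {A B : ℝ → Matrix ι ι ℝ} (hA : Continuous A)
    (hB : Continuous B) {X Y : ℝ → Matrix ι ι ℝ} (hX : ∀ t, HasDerivAt X (A t * X t + X t * B t) t)
    (hY : ∀ t, HasDerivAt Y (A t * Y t + Y t * B t) t) {t₀ : ℝ} (h₀ : X t₀ = Y t₀) : X = Y :=
  eq_of_hasDerivAt_clm_apply
    (B := fun t => ContinuousLinearMap.mul ℝ (Matrix ι ι ℝ) (A t) +
      (ContinuousLinearMap.mul ℝ (Matrix ι ι ℝ)).flip (B t)) (by fun_prop) hX hY h₀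

theorem eq_of_hasDerivAt_matrix_mul {A : ℝ → Matrix ι ι ℝ} (hA : Continuous A)
    {X Y : ℝ → Matrix ι ι ℝ} (hX : ∀ t, HasDerivAt X (A t * X t) t)
    (hY : ∀ t, HasDerivAt Y (A t * Y t) t) {t₀ : ℝ} (h₀ : X t₀ = Y t₀) : X = Y :=
  eq_of_hasDerivAt_matrix_mul_add_mul hA (B := 0) continuous_const (by simpa using hX)
    (by simpa using hY) h₀

theorem eq_of_hasDerivAt_mulVec {A : ℝ → Matrix ι ι ℝ} (hA : Continuous A) {x y : ℝ → ι → ℝ}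
    (hx : ∀ t, HasDerivAt x (A t *ᵥ x t) t) (hy : ∀ t, HasDerivAt y (A t *ᵥ y t) t) {t₀ : ℝ}
    (h₀ : x t₀ = y t₀) : x = y := by
  have hcont : Continuous fun t => LinearMap.toContinuousLinearMap (A t).mulVecLin :=
    continuous_clm_apply.2 fun v => hA.matrix_mulVec continuous_const
  exact eq_of_hasDerivAt_clm_apply hcont hx hy h₀

theorem exists_transpose_mul_self_eq {a L : ℝ → Matrix ι ι ℝ} (hL : Continuous L)
    (ha : (a 0).PosSemidef) (ha' : ∀ t, HasDerivAt a ((L t)ᵀ * a t + a t * L t) t) :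
    ∃ w : ℝ → Matrix ι ι ℝ, (∀ t, HasDerivAt w (w t * L t) t) ∧ ∀ t, (w t)ᵀ * w t = a t := by
  classical
  obtain ⟨v, hv₀, hv⟩ := exists_hasDerivAt_matrix_mul hL.matrix_transpose (CFC.sqrt (a 0))
  have hw (t : ℝ) : HasDerivAt (fun s => (v s)ᵀ) ((v t)ᵀ * L t) t := by
    simpa [transpose_mul] using hasDerivAt_matrix_transpose (hv t)
  have hvw (t : ℝ) : HasDerivAt (fun s => v s * (v s)ᵀ)
      ((L t)ᵀ * (v t * (v t)ᵀ) + v t * (v t)ᵀ * L t) t := by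
    simpa only [mul_assoc] using hasDerivAt_matrix_mul (hv t) (hw t)
  have hsqrt : CFC.sqrt (a 0) * (CFC.sqrt (a 0))ᵀ = a 0 := by
    rw [← conjTranspose_eq_transpose_of_trivial, (CFC.sqrt_nonneg (a 0)).posSemidef.isHermitian.eq]
    exact CFC.sqrt_mul_sqrt_self _ ha.nonneg
  refine ⟨fun t => (v t)ᵀ, hw, fun t => ?_⟩
  rw [transpose_transpose]
  exact congrFun (eq_of_hasDerivAt_matrix_mul_add_mul hL.matrix_transpose hL hvw ha' (t₀ := 0)
    (by rw [hv₀, hsqrt])) t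

end MatrixODE

section GeometricMean

open scoped ComplexOrder

variable {ι 𝕜 : Type*} [Fintype ι] [RCLike 𝕜] {P Q X Y : Matrix ι ι 𝕜}

open scoped Classical in
theorem posDef_sqrt (hP : P.PosDef) : (CFC.sqrt P).PosDef :=
  isStrictlyPositive_iff_posDef.1 (.sqrt P (isStrictlyPositive_iff_posDef.2 hP))

theorem posDef_conj (hX : X.PosDef) (hQ : Q.PosDef) : (X * Q * X).PosDef := by
  classical
  have h := (IsUnit.posDef_star_left_conjugate_iff hX.isUnit).2 hQ
  rwa [star_eq_conjTranspose, hX.isHermitian.eq] at h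

theorem exists_posDef_mul_mul_eq (hP : P.PosDef) (hQ : Q.PosDef) :
    ∃ X : Matrix ι ι 𝕜, X.PosDef ∧ X * P * X = Q := by
  classical
  set s := CFC.sqrt P
  set y := CFC.sqrt (s * Q * s)
  have hs : s.PosDef := posDef_sqrt hP
  have hss : s * s = P := CFC.sqrt_mul_sqrt_self P hP.posSemidef.nonneg
  have hyy : y * y = s * Q * s := CFC.sqrt_mul_sqrt_self _ (posDef_conj hs hQ).posSemidef.nonneg
  have hu := (isUnit_iff_isUnit_det s).1 hs.isUnit
  refine ⟨s⁻¹ * y * s⁻¹, posDef_conj hs.inv (posDef_sqrt (posDef_conj hs hQ)), ?_⟩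
  calc s⁻¹ * y * s⁻¹ * P * (s⁻¹ * y * s⁻¹)
      = s⁻¹ * y * (s⁻¹ * s) * (s * s⁻¹) * y * s⁻¹ := by rw [← hss]; noncomm_ring
    _ = s⁻¹ * (y * y) * s⁻¹ := by
        rw [nonsing_inv_mul s hu, mul_nonsing_inv s hu]; noncomm_ring
    _ = (s⁻¹ * s) * Q * (s * s⁻¹) := by rw [hyy]; noncomm_ring
    _ = Q := by rw [nonsing_inv_mul s hu, mul_nonsing_inv s hu, one_mul, mul_one]

theorem eq_of_posDef_mul_mul_eq (hP : P.PosDef) (hX : X.PosDef) (hY : Y.PosDef)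
    (hXY : X * P * X = Y * P * Y) : X = Y := by
  classical
  set s := CFC.sqrt P
  have hs : s.PosDef := posDef_sqrt hP
  have hss : s * s = P := CFC.sqrt_mul_sqrt_self P hP.posSemidef.nonneg
  have hsqrt : ∀ Z : Matrix ι ι 𝕜, Z.PosDef → CFC.sqrt (s * (Z * P * Z) * s) = s * Z * s :=
    fun Z hZ => CFC.sqrt_unique (by rw [← hss]; noncomm_ring) (posDef_conj hs hZ).posSemidef.nonneg
  have hconj : s * X * s = s * Y * s := by rw [← hsqrt X hX, ← hsqrt Y hY, hXY]
  exact hs.isUnit.mul_left_cancel (hs.isUnit.mul_right_cancel hconj)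

end GeometricMean

section InvariantForm

theorem exists_fixedPoint_mem_closure_convexHull_orbit {E : Type*} [NormedAddCommGroup E]
    [NormedSpace ℝ E] [ProperSpace E] (L : E →L[ℝ] E) {x : E}
    (hx : Bornology.IsBounded (Set.range fun k => L^[k] x)) :
    ∃ y ∈ closure (convexHull ℝ (Set.range fun k => L^[k] x)), L y = y := by
  set a : ℕ → E := fun k => birkhoffAverage ℝ L id (k + 1) x
  have ha : ∀ k, a k ∈ convexHull ℝ (Set.range fun k => L^[k] x) := fun k => by
    simp only [a, birkhoffAverage, birkhoffSum, Finset.smul_sum]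
    refine (convex_convexHull ℝ _).sum_mem (fun _ _ => by positivity) ?_
      fun i _ => subset_convexHull ℝ _ ⟨i, rfl⟩
    rw [Finset.sum_const, Finset.card_range, nsmul_eq_mul]
    exact mul_inv_cancel₀ (by positivity)
  have hLa : ∀ k, birkhoffAverage ℝ L id (k + 1) (L x) = L (a k) := fun k => by
    simp only [a, birkhoffAverage, birkhoffSum, id, map_smul, map_sum,
      ← Function.iterate_succ_apply, Function.iterate_succ_apply']
  obtain ⟨y, hy, φ, hφ, hlim⟩ := tendsto_subseq_of_bounded (isBounded_convexHull.2 hx) ha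
  have hdiff : Filter.Tendsto (fun k => L (a (φ k)) - a (φ k)) Filter.atTop (nhds 0) := by
    simpa only [← hLa, a, Function.comp_def] using
      (tendsto_birkhoffAverage_apply_sub_birkhoffAverage ℝ hx).comp
        ((Filter.tendsto_add_atTop_nat 1).comp hφ.tendsto_atTop)
  refine ⟨y, hy, sub_eq_zero.1 (tendsto_nhds_unique ?_ hdiff)⟩
  exact ((L.continuous.tendsto y).comp hlim).sub hlim

variable {ι : Type*} [Fintype ι]

theorem posDef_of_mem_closure_convexHull {s : Set (Matrix ι ι ℝ)} {c : ℝ} (hc : 0 ≤ c)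
    (hs : ∀ A ∈ s, A.IsSymm ∧ ∀ v, v ⬝ᵥ v ≤ c * (v ⬝ᵥ (A *ᵥ v))) {A : Matrix ι ι ℝ}
    (hA : A ∈ closure (convexHull ℝ s)) : A.PosDef := by
  set K := {A : Matrix ι ι ℝ | A.IsSymm ∧ ∀ v, v ⬝ᵥ v ≤ c * (v ⬝ᵥ (A *ᵥ v))}
  have hclosed : IsClosed K := by
    simp only [K, Matrix.IsSymm, Set.ofPred_and, Set.ofPred_forall]
    refine (isClosed_eq (by fun_prop) continuous_id).inter (isClosed_iInter fun v => ?_)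
    exact isClosed_le (by fun_prop) (by fun_prop)
  have hconvex : Convex ℝ K := by
    rintro A ⟨hA, hA'⟩ B ⟨hB, hB'⟩ a b ha hb hab
    refine ⟨(hA.smul a).add (hB.smul b), fun v => ?_⟩
    simp only [add_mulVec, smul_mulVec, dotProduct_add, dotProduct_smul, smul_eq_mul]
    linear_combination a * hA' v + b * hB' v - (v ⬝ᵥ v) * hab
  obtain ⟨hsymm, hle⟩ := closure_minimal (convexHull_min hs hconvex) hclosed hA
  refine PosDef.of_dotProduct_mulVec_pos (by
    rwa [IsHermitian, conjTranspose_eq_transpose_of_trivial]) fun v hv => ?_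
  have hpos : 0 < v ⬝ᵥ v := by simpa using dotProduct_self_star_pos_iff.2 hv
  simpa using pos_of_mul_pos_right (hpos.trans_le (hle v)) hc

variable [DecidableEq ι]

open scoped Matrix.Norms.L2Operator

theorem exists_l2_opNorm_le {α : Type*} {A : α → Matrix ι ι ℝ}
    (hA : ∀ v, ∃ C, ∀ k, ‖A k *ᵥ v‖ ≤ C) : ∃ C, ∀ k, ‖A k‖ ≤ C := by
  refine banach_steinhaus (g := fun k => toEuclideanCLM (𝕜 := ℝ) (A k)) fun v => ?_
  obtain ⟨C, hC⟩ := hA v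
  let e : (ι → ℝ) →L[ℝ] EuclideanSpace ℝ ι := (EuclideanSpace.equiv ι ℝ).symm
  exact ⟨‖e‖ * C, fun k => (e.le_opNorm (A k *ᵥ v)).trans (by gcongr; exact hC k)⟩

theorem mulVec_dotProduct_mulVec_self_le (A : Matrix ι ι ℝ) (v : ι → ℝ) :
    (A *ᵥ v) ⬝ᵥ (A *ᵥ v) ≤ ‖A‖ ^ 2 * (v ⬝ᵥ v) := by
  have hsq : ∀ u : ι → ℝ, u ⬝ᵥ u = ‖WithLp.toLp 2 u‖ ^ 2 := fun u => by
    rw [EuclideanSpace.real_norm_sq_eq]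
    simp only [dotProduct, sq]
  rw [hsq, hsq, ← mul_pow]
  gcongr
  exact l2_opNorm_mulVec A (WithLp.toLp 2 v)

theorem exists_posDef_transpose_mul_mul_eq {M : Matrix ι ι ℝ} (hM : IsUnit M.det) {C : ℝ}
    (hpow : ∀ k, ‖M ^ k‖ ≤ C) (hinv : ∀ k, ‖(M ^ k)⁻¹‖ ≤ C) :
    ∃ P : Matrix ι ι ℝ, P.PosDef ∧ Mᵀ * P * M = P := by
  let L : Matrix ι ι ℝ →L[ℝ] Matrix ι ι ℝ := ContinuousLinearMap.mulLeftRight ℝ _ Mᵀ M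
  have hL : ∀ k, L^[k] 1 = (M ^ k)ᵀ * M ^ k := fun k => by
    induction k with
    | zero => simp
    | succ k ih =>
      rw [Function.iterate_succ_apply', ih, pow_succ, transpose_mul]
      simp [L, mul_assoc]
  have hbdd : Bornology.IsBounded (Set.range fun k => L^[k] 1) := by
    refine isBounded_iff_forall_norm_le.2 ⟨C * C, Set.forall_mem_range.2 fun k => ?_⟩
    rw [hL, ← conjTranspose_eq_transpose_of_trivial, l2_opNorm_conjTranspose_mul_self]
    exact mul_self_le_mul_self (norm_nonneg _) (hpow k)
  have hlower : ∀ k v, v ⬝ᵥ v ≤ C ^ 2 * (v ⬝ᵥ ((M ^ k)ᵀ * M ^ k) *ᵥ v) := fun k v =>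
    calc v ⬝ᵥ v = ((M ^ k)⁻¹ *ᵥ (M ^ k *ᵥ v)) ⬝ᵥ ((M ^ k)⁻¹ *ᵥ (M ^ k *ᵥ v)) := by
          rw [mulVec_mulVec, nonsing_inv_mul _ (by simpa using hM.pow k), one_mulVec]
      _ ≤ ‖(M ^ k)⁻¹‖ ^ 2 * ((M ^ k *ᵥ v) ⬝ᵥ (M ^ k *ᵥ v)) := mulVec_dotProduct_mulVec_self_le _ _
      _ ≤ C ^ 2 * ((M ^ k *ᵥ v) ⬝ᵥ (M ^ k *ᵥ v)) := by
          gcongr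
          exacts [by simpa using dotProduct_star_self_nonneg (M ^ k *ᵥ v), hinv k]
      _ = C ^ 2 * (v ⬝ᵥ ((M ^ k)ᵀ * M ^ k) *ᵥ v) := by
          rw [← mulVec_mulVec, dotProduct_mulVec v, vecMul_transpose]
  obtain ⟨P, hP, hPL⟩ := exists_fixedPoint_mem_closure_convexHull_orbit L hbdd
  refine ⟨P, posDef_of_mem_closure_convexHull (sq_nonneg C) (Set.forall_mem_range.2 fun k => ?_) hP,
    by simpa [L] using hPL⟩
  simp only [hL]
  exact ⟨by simp [Matrix.IsSymm], hlower k⟩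

end InvariantForm

section Symplectic

variable {l : Type*} [Fintype l] [DecidableEq l] {M : Matrix (l ⊕ l) (l ⊕ l) ℝ}

open scoped Matrix.Norms.L2Operator in
theorem l2_opNorm_inv_of_mem_symplecticGroup (hM : M ∈ symplecticGroup l ℝ) : ‖M⁻¹‖ = ‖M‖ := by
  have hJ : J l ℝ ∈ unitary (Matrix (l ⊕ l) (l ⊕ l) ℝ) := by
    rw [Unitary.mem_iff, star_eq_conjTranspose, conjTranspose_eq_transpose_of_trivial, J_transpose]
    simp [J_squared]
  rw [SymplecticGroup.inv_eq_symplectic_inv M hM, CStarRing.norm_mul_mem_unitary _ hJ, neg_mul,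
    norm_neg, CStarRing.norm_mem_unitary_mul _ hJ, ← conjTranspose_eq_transpose_of_trivial,
    l2_opNorm_conjTranspose]

theorem exists_posDef_mem_symplecticGroup_of_transpose_mul_mul_eq (hM : M ∈ symplecticGroup l ℝ)
    {P : Matrix (l ⊕ l) (l ⊕ l) ℝ} (hP : P.PosDef) (hMP : Mᵀ * P * M = P) :
    ∃ X : Matrix (l ⊕ l) (l ⊕ l) ℝ, X.PosDef ∧ X ∈ symplecticGroup l ℝ ∧ M * X * Mᵀ = X := by
  have hJJ : (J l ℝ)ᵀ * J l ℝ = 1 := by rw [J_transpose, neg_mul, J_squared, neg_neg]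
  have hJ : IsUnit (J l ℝ) := (isUnit_iff_isUnit_det _).2 (isUnit_det_J l ℝ)
  have hMJ : M * J l ℝ * Mᵀ = J l ℝ := SymplecticGroup.mem_iff.1 hM
  have hMu : IsUnit M := (isUnit_iff_isUnit_det M).2 (SymplecticGroup.symplectic_det hM)
  have hconj : ∀ {U : Matrix (l ⊕ l) (l ⊕ l) ℝ}, IsUnit U → ∀ {A}, A.PosDef → (U * A * Uᵀ).PosDef :=
    fun hU _ hA => (IsUnit.posDef_star_right_conjugate_iff hU).2 hA
  obtain ⟨X, hX, hXP⟩ := exists_posDef_mul_mul_eq hP (hconj hJ hP)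
  have hXt : Xᵀ = X := by simpa using hX.isHermitian.eq
  have hXu : IsUnit X.det := (isUnit_iff_isUnit_det X).1 hX.isUnit
  -- The equation `X P X = J P Jᵀ`, which determines `X`, is also solved by `J X⁻¹ Jᵀ` and `M X Mᵀ`.
  have hXinv : X = J l ℝ * X⁻¹ * (J l ℝ)ᵀ := by
    refine eq_of_posDef_mul_mul_eq hP hX (hconj hJ hX.inv) (hXP.trans (Eq.symm ?_))
    calc J l ℝ * X⁻¹ * (J l ℝ)ᵀ * P * (J l ℝ * X⁻¹ * (J l ℝ)ᵀ)
        = J l ℝ * X⁻¹ * (J l ℝ * P * (J l ℝ)ᵀ) * X⁻¹ * (J l ℝ)ᵀ := by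
          rw [J_transpose]; noncomm_ring
      _ = J l ℝ * (X⁻¹ * X) * P * (X * X⁻¹) * (J l ℝ)ᵀ := by rw [← hXP]; noncomm_ring
      _ = J l ℝ * P * (J l ℝ)ᵀ := by
          rw [nonsing_inv_mul X hXu, mul_nonsing_inv X hXu, mul_one, mul_one]
  refine ⟨X, hX, SymplecticGroup.mem_iff.2 ?_, ?_⟩
  · calc X * J l ℝ * Xᵀ = J l ℝ * X⁻¹ * (J l ℝ)ᵀ * J l ℝ * X := by rw [hXt, ← hXinv]
      _ = J l ℝ := by
        rw [mul_assoc _ (J l ℝ)ᵀ, hJJ, mul_one, nonsing_inv_mul_cancel_right X _ hXu]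
  · refine eq_of_posDef_mul_mul_eq hP (hconj hMu hX) hX (Eq.trans ?_ hXP.symm)
    calc M * X * Mᵀ * P * (M * X * Mᵀ) = M * (X * (Mᵀ * P * M) * X) * Mᵀ := by noncomm_ring
      _ = M * (J l ℝ * (Mᵀ * P * M) * (J l ℝ)ᵀ) * Mᵀ := by rw [hMP, hXP]
      _ = (M * J l ℝ * Mᵀ) * P * (M * J l ℝ * Mᵀ)ᵀ := by
        simp only [transpose_mul, transpose_transpose, mul_assoc]
      _ = J l ℝ * P * (J l ℝ)ᵀ := by rw [hMJ]

theorem exists_posDef_mem_symplecticGroup_mul_mul_transpose_eq (hM : M ∈ symplecticGroup l ℝ)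
    (hbdd : ∀ v, ∃ C, ∀ k : ℕ, ‖M ^ k *ᵥ v‖ ≤ C) :
    ∃ X : Matrix (l ⊕ l) (l ⊕ l) ℝ, X.PosDef ∧ X ∈ symplecticGroup l ℝ ∧ M * X * Mᵀ = X := by
  obtain ⟨C, hC⟩ := exists_l2_opNorm_le hbdd
  obtain ⟨P, hP, hMP⟩ := exists_posDef_transpose_mul_mul_eq (SymplecticGroup.symplectic_det hM) hC
    fun k => by
      rw [l2_opNorm_inv_of_mem_symplecticGroup (pow_mem hM k)]
      exact hC k
  exact exists_posDef_mem_symplecticGroup_of_transpose_mul_mul_eq hM hP hMP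

end Symplectic

section FundamentalMatrix

variable {ι : Type*} [Fintype ι] [DecidableEq ι]

/-- `Φ` is the principal fundamental matrix, normalised at time `0`, of the linear system
`ẋ = B x`; its value at a period of `B` is the monodromy matrix. -/
structure IsFundamentalMatrix (B Φ : ℝ → Matrix ι ι ℝ) : Prop where
  apply_zero : Φ 0 = 1
  hasDerivAt (t : ℝ) : HasDerivAt Φ (B t * Φ t) t

variable {B Φ : ℝ → Matrix ι ι ℝ} {T : ℝ}

theorem exists_isFundamentalMatrix (hB : Continuous B) : ∃ Φ, IsFundamentalMatrix B Φ :=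
  let ⟨Φ, h₀, h⟩ := exists_hasDerivAt_matrix_mul hB 1
  ⟨Φ, h₀, h⟩

namespace IsFundamentalMatrix

open scoped Matrix.Norms.Operator in
theorem continuous (hΦ : IsFundamentalMatrix B Φ) : Continuous Φ :=
  continuous_iff_continuousAt.2 fun t => (hΦ.hasDerivAt t).continuousAt

theorem hasDerivAt_mulVec (hΦ : IsFundamentalMatrix B Φ) (v : ι → ℝ) (t : ℝ) :
    HasDerivAt (fun s => Φ s *ᵥ v) (B t *ᵥ (Φ t *ᵥ v)) t := by
  simpa using LinHam.hasDerivAt_mulVec (hΦ.hasDerivAt t) (hasDerivAt_const t v)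

theorem eq_mulVec (hΦ : IsFundamentalMatrix B Φ) (hB : Continuous B) {x : ℝ → ι → ℝ}
    (hx : ∀ t, HasDerivAt x (B t *ᵥ x t) t) (t : ℝ) : x t = Φ t *ᵥ x 0 :=
  congrFun (eq_of_hasDerivAt_mulVec hB hx (hΦ.hasDerivAt_mulVec (x 0)) (t₀ := 0)
    (by simp [hΦ.apply_zero])) t

open scoped Matrix.Norms.Operator in
theorem apply_add (hΦ : IsFundamentalMatrix B Φ) (hB : Continuous B)
    (hBT : Function.Periodic B T) (t : ℝ) : Φ (t + T) = Φ t * Φ T := by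
  have hshift (s : ℝ) : HasDerivAt (fun s => Φ (s + T)) (B s * Φ (s + T)) s :=
    hBT s ▸ (hΦ.hasDerivAt (s + T)).comp_add_const s T
  have hmul (s : ℝ) : HasDerivAt (fun s => Φ s * Φ T) (B s * (Φ s * Φ T)) s := by
    simpa [mul_assoc] using hasDerivAt_matrix_mul (hΦ.hasDerivAt s) (hasDerivAt_const s (Φ T))
  exact congrFun (eq_of_hasDerivAt_matrix_mul hB hshift hmul (t₀ := 0)
    (by simp [hΦ.apply_zero])) t

theorem apply_natCast_mul (hΦ : IsFundamentalMatrix B Φ) (hB : Continuous B)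
    (hBT : Function.Periodic B T) (k : ℕ) : Φ (k * T) = Φ T ^ k := by
  induction k with
  | zero => simp [hΦ.apply_zero]
  | succ k ih => rw [Nat.cast_succ, add_one_mul, hΦ.apply_add hB hBT, ih, pow_succ]

open scoped Matrix.Norms.Operator in
theorem hasDerivAt_mul_mul_transpose (hΦ : IsFundamentalMatrix B Φ) (H : Matrix ι ι ℝ) (t : ℝ) :
    HasDerivAt (fun s => Φ s * H * (Φ s)ᵀ)
      (B t * (Φ t * H * (Φ t)ᵀ) + Φ t * H * (Φ t)ᵀ * (B t)ᵀ) t := by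
  have h := hasDerivAt_matrix_mul
    (hasDerivAt_matrix_mul (hΦ.hasDerivAt t) (hasDerivAt_const t H))
    (hasDerivAt_matrix_transpose (hΦ.hasDerivAt t))
  simpa [mul_assoc, transpose_mul] using h

end IsFundamentalMatrix

end FundamentalMatrix

section HamiltonianSystem

variable {l : Type*} [Fintype l] [DecidableEq l] {B Φ : ℝ → Matrix (l ⊕ l) (l ⊕ l) ℝ} {T : ℝ}

open scoped Matrix.Norms.Operator in
theorem IsFundamentalMatrix.mem_symplecticGroup (hΦ : IsFundamentalMatrix B Φ) (hB : Continuous B)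
    (hBJ : ∀ t, B t * J l ℝ + J l ℝ * (B t)ᵀ = 0) (t : ℝ) : Φ t ∈ symplecticGroup l ℝ :=
  SymplecticGroup.mem_iff.2 <| congrFun (eq_of_hasDerivAt_matrix_mul_add_mul hB
    hB.matrix_transpose (hΦ.hasDerivAt_mul_mul_transpose (J l ℝ)) (Y := fun _ => J l ℝ)
    (fun s => (hBJ s).symm ▸ hasDerivAt_const s _) (t₀ := 0) (by simp [hΦ.apply_zero])) t

theorem exists_periodic_posDef_of_bounded (hT : 0 ≤ T) (hB : Continuous B)
    (hBT : Function.Periodic B T) (hBJ : ∀ t, B t * J l ℝ + J l ℝ * (B t)ᵀ = 0)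
    (hbdd : ∀ x : ℝ → l ⊕ l → ℝ, (∀ t, HasDerivAt x (B t *ᵥ x t) t) →
      ∃ C, ∀ t, 0 ≤ t → ‖x t‖ ≤ C) :
    ∃ F : ℝ → Matrix (l ⊕ l) (l ⊕ l) ℝ, Function.Periodic F T ∧ (∀ t, (F t).PosDef) ∧
      (∀ t, F t ∈ symplecticGroup l ℝ) ∧ ∀ t, HasDerivAt F (B t * F t + F t * (B t)ᵀ) t := by
  obtain ⟨Φ, hΦ⟩ := exists_isFundamentalMatrix hB
  have hsymp := hΦ.mem_symplecticGroup hB hBJ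
  have hpow (v : l ⊕ l → ℝ) : ∃ C, ∀ k : ℕ, ‖Φ T ^ k *ᵥ v‖ ≤ C := by
    obtain ⟨C, hC⟩ := hbdd _ (hΦ.hasDerivAt_mulVec v)
    exact ⟨C, fun k => hΦ.apply_natCast_mul hB hBT k ▸ hC (k * T) (by positivity)⟩
  obtain ⟨X, hX, hXs, hinv⟩ :=
    exists_posDef_mem_symplecticGroup_mul_mul_transpose_eq (hsymp T) hpow
  refine ⟨fun t => Φ t * X * (Φ t)ᵀ, fun t => ?_, fun t => ?_, fun t => ?_,
    hΦ.hasDerivAt_mul_mul_transpose X⟩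
  · calc Φ (t + T) * X * (Φ (t + T))ᵀ = Φ t * (Φ T * X * (Φ T)ᵀ) * (Φ t)ᵀ := by
          simp only [hΦ.apply_add hB hBT, transpose_mul, mul_assoc]
      _ = Φ t * X * (Φ t)ᵀ := by rw [hinv]
  · have hinj := vecMul_injective_of_isUnit
      ((isUnit_iff_isUnit_det _).2 (SymplecticGroup.symplectic_det (hsymp t)))
    simpa using hX.mul_mul_conjTranspose_same hinj
  · exact mul_mem (mul_mem (hsymp t) hXs) (SymplecticGroup.transpose_mem (hsymp t))

end HamiltonianSystem

section Observability

variable {ι ι' : Type*} [Fintype ι] [Fintype ι'] {B : ℝ → Matrix (ι ⊕ ι') (ι ⊕ ι') ℝ}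
  {z : ℝ → ι ⊕ ι' → ℝ} {T : ℝ}

theorem hasDerivAt_comp_inl (hz : ∀ t, HasDerivAt z (B t *ᵥ z t) t) (t : ℝ) :
    HasDerivAt (fun s => z s ∘ Sum.inl)
      ((B t).toBlocks₁₁ *ᵥ (z t ∘ Sum.inl) + (B t).toBlocks₁₂ *ᵥ (z t ∘ Sum.inr)) t := by
  have h := hz t
  rw [← fromBlocks_toBlocks (B t), fromBlocks_mulVec, hasDerivAt_pi] at h
  exact hasDerivAt_pi.2 fun i => h (Sum.inl i)

theorem eq_zero_of_comp_inl_eventuallyEq_zero (hB : Continuous B)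
    (hz : ∀ t, HasDerivAt z (B t *ᵥ z t) t) {t₀ : ℝ}
    (hinj : Function.Injective (B t₀).toBlocks₁₂.mulVec)
    (hx : (fun t => z t ∘ Sum.inl) =ᶠ[𝓝 t₀] 0) : z = 0 := by
  have hx₀ : z t₀ ∘ Sum.inl = 0 := hx.self_of_nhds
  have hp₀ : z t₀ ∘ Sum.inr = 0 := by
    have hderiv := (hasDerivAt_comp_inl hz t₀).unique
      ((hasDerivAt_const t₀ (0 : ι → ℝ)).congr_of_eventuallyEq hx)
    rw [hx₀, mulVec_zero, zero_add] at hderiv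
    exact hinj (hderiv.trans (mulVec_zero _).symm)
  have hz₀ : z t₀ = 0 := by
    rw [← Sum.elim_comp_inl_inr (z t₀), hx₀, hp₀, Sum.elim_zero_zero]
  exact eq_of_hasDerivAt_mulVec hB hz (y := 0) (fun t => by simp) hz₀

open scoped Matrix.Norms.Operator in
theorem exists_norm_le_mul_of_norm_comp_inl_le (hT : 0 < T) (hB : Continuous B)
    (hinj : ∀ t, Function.Injective (B t).toBlocks₁₂.mulVec) :
    ∃ c : ℝ, ∀ z : ℝ → ι ⊕ ι' → ℝ, (∀ t, HasDerivAt z (B t *ᵥ z t) t) → ∀ C : ℝ, 0 ≤ C →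
      (∀ t ∈ Set.Icc 0 T, ‖z t ∘ Sum.inl‖ ≤ C) → ∀ t ∈ Set.Icc 0 T, ‖z t‖ ≤ c * C := by
  classical
  obtain ⟨Φ, hΦ⟩ := exists_isFundamentalMatrix hB
  -- The positions over `[0, T]` determine the initial value; by finite dimension, they do so with
  -- a bound.
  let obs : (ι ⊕ ι' → ℝ) →ₗ[ℝ] C(Set.Icc 0 T, ι → ℝ) :=
    { toFun := fun v => ⟨fun t => (Φ t *ᵥ v) ∘ Sum.inl, continuous_pi fun i =>
        (continuous_apply (Sum.inl i)).comp
          ((hΦ.continuous.comp continuous_subtype_val).matrix_mulVec continuous_const)⟩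
      map_add' := fun u v => by ext t i; simp [mulVec_add]
      map_smul' := fun c u => by ext t i; simp [mulVec_smul] }
  have hker : LinearMap.ker obs = ⊥ := by
    refine LinearMap.ker_eq_bot'.2 fun v hv => ?_
    have hx : (fun t => (Φ t *ᵥ v) ∘ Sum.inl) =ᶠ[𝓝 (T / 2)] 0 := by
      filter_upwards [Icc_mem_nhds (half_pos hT) (half_lt_self hT)] with t ht
      exact DFunLike.congr_fun hv ⟨t, ht⟩
    simpa [hΦ.apply_zero] using congrFun
      (eq_zero_of_comp_inl_eventuallyEq_zero hB (hΦ.hasDerivAt_mulVec v) (hinj _) hx) 0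
  obtain ⟨K, -, hK⟩ := obs.exists_antilipschitzWith hker
  obtain ⟨N, hN⟩ := isCompact_Icc.bddAbove_image hΦ.continuous.norm.continuousOn
  refine ⟨N * K, fun z hz C hC hx t ht => ?_⟩
  have hzΦ := hΦ.eq_mulVec hB hz
  have hobs : ‖obs (z 0)‖ ≤ C :=
    (ContinuousMap.norm_le _ hC).2 fun s => (congrArg (‖· ∘ Sum.inl‖) (hzΦ s)).ge.trans (hx s s.2)
  have hN' : ‖Φ t‖ ≤ N := hN ⟨t, ht, rfl⟩
  calc ‖z t‖ ≤ ‖Φ t‖ * ‖z 0‖ := hzΦ t ▸ linfty_opNorm_mulVec _ _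
    _ ≤ N * (K * C) := mul_le_mul hN'
        ((ZeroHomClass.bound_of_antilipschitz obs hK (z 0)).trans (by gcongr))
        (norm_nonneg _) ((norm_nonneg _).trans hN')
    _ = N * K * C := (mul_assoc _ _ _).symm

theorem exists_norm_le_of_norm_comp_inl_le (hT : 0 < T) (hB : Continuous B)
    (hBT : Function.Periodic B T) (hinj : ∀ t, Function.Injective (B t).toBlocks₁₂.mulVec)
    (hz : ∀ t, HasDerivAt z (B t *ᵥ z t) t) {C : ℝ} (hC : ∀ t, ‖z t ∘ Sum.inl‖ ≤ C) :
    ∃ C', ∀ t, ‖z t‖ ≤ C' := by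
  obtain ⟨c, hc⟩ := exists_norm_le_mul_of_norm_comp_inl_le hT hB hinj
  refine ⟨c * C, fun t => ?_⟩
  obtain ⟨k, hk, -⟩ := existsUnique_sub_zsmul_mem_Ico hT t 0
  rw [zero_add] at hk
  have hshift (s : ℝ) : HasDerivAt (fun s => z (s + k • T)) (B s *ᵥ z (s + k • T)) s :=
    hBT.zsmul k s ▸ (hz (s + k • T)).comp_add_const s (k • T)
  simpa using hc _ hshift C ((norm_nonneg _).trans (hC 0)) (fun s _ => hC _) (t - k • T)
    (Set.Ico_subset_Icc_self hk)

end Observability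

section Lyapunov

variable {ι : Type*} [Fintype ι] {B F : ℝ → Matrix ι ι ℝ} {z : ℝ → ι → ℝ}

open scoped Matrix.Norms.Operator in
theorem exists_sq_apply_le_mul (hB : Continuous B) (hF₀ : (F 0).PosDef)
    (hF : ∀ t, HasDerivAt F (B t * F t + F t * (B t)ᵀ) t)
    (hz : ∀ t, HasDerivAt z (B t *ᵥ z t) t) : ∃ C, 0 ≤ C ∧ ∀ t i, z t i ^ 2 ≤ C * F t i i := by
  classical
  obtain ⟨W, hW, hWF⟩ := exists_transpose_mul_self_eq hB.matrix_transpose hF₀.posSemidef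
    (by simpa only [transpose_transpose] using hF)
  have hdet : IsUnit ((W 0)ᵀ).det := by
    refine isUnit_of_mul_isUnit_left (y := (W 0).det) ?_
    rw [← det_mul, hWF, ← isUnit_iff_isUnit_det]
    exact hF₀.isUnit
  set y := ((W 0)ᵀ)⁻¹ *ᵥ z 0 with hy
  have hWy (t : ℝ) : HasDerivAt (fun r => (W r)ᵀ *ᵥ y) (B t *ᵥ ((W t)ᵀ *ᵥ y)) t := by
    simpa [transpose_mul] using
      hasDerivAt_mulVec (hasDerivAt_matrix_transpose (hW t)) (hasDerivAt_const t y)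
  have hzy : z = fun t => (W t)ᵀ *ᵥ y := eq_of_hasDerivAt_mulVec hB hz hWy (t₀ := 0) <| by
    rw [hy, mulVec_mulVec, mul_nonsing_inv _ hdet, one_mulVec]
  refine ⟨∑ j, y j ^ 2, by positivity, fun t i => ?_⟩
  calc z t i ^ 2 = (∑ j, W t j i * y j) ^ 2 := by rw [hzy]; rfl
    _ ≤ (∑ j, W t j i ^ 2) * ∑ j, y j ^ 2 := Finset.sum_mul_sq_le_sq_mul_sq _ _ _
    _ = (∑ j, y j ^ 2) * F t i i := by simp [← hWF, mul_apply, sq, mul_comm]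

end Lyapunov

section Envelope

variable {n : ℕ} {κ R m w s : ℝ → Mat n}

/-- The envelope equation as a first-order system for `w` and `s = w⁻¹ (ẇ m - w R m)`: the
matrix Riccati equation for `s` involves `w` only through `wᵀ w`. -/
structure IsEnvelopePair (κ R m w s : ℝ → Mat n) : Prop where
  isUnit_det (t : ℝ) : IsUnit (w t).det
  hasDerivAt_fst (t : ℝ) : HasDerivAt w (w t * (R t + s t * (m t)⁻¹)) t
  hasDerivAt_snd (t : ℝ) : HasDerivAt s (((w t)ᵀ * w t)⁻¹ * (m t)⁻¹ * ((w t)ᵀ * w t)⁻¹ - κ t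
    - s t * (R t)ᵀ - R t * s t - s t * (m t)⁻¹ * s t) t

namespace IsEnvelopePair

theorem momentum_eq (hm : ∀ t, IsUnit (m t).det) (h : IsEnvelopePair κ R m w s) (t : ℝ) :
    deriv w t * m t - w t * R t * m t = w t * s t := by
  rw [deriv_matrix_eq (h.hasDerivAt_fst t)]
  calc w t * (R t + s t * (m t)⁻¹) * m t - w t * R t * m t = w t * s t * ((m t)⁻¹ * m t) := by
        noncomm_ring
    _ = w t * s t := by rw [nonsing_inv_mul _ (hm t), mul_one]

theorem envelopeS_eq (hm : ∀ t, IsUnit (m t).det) (h : IsEnvelopePair κ R m w s) (t : ℝ) :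
    envelopeS R m w t = fromBlocks ((w t)ᵀ)⁻¹ 0 (-(w t * s t)) (w t) := by
  rw [envelopeS, sub_mul, ← h.momentum_eq hm, neg_sub]

theorem envelopeS_mem_symplecticGroup_iff (hm : ∀ t, IsUnit (m t).det)
    (h : IsEnvelopePair κ R m w s) (t : ℝ) :
    envelopeS R m w t ∈ symplecticGroup (Fin n) ℝ ↔ (s t).IsSymm := by
  have hw := h.isUnit_det t
  have hwt : IsUnit ((w t)ᵀ).det := by rwa [det_transpose]
  simp [h.envelopeS_eq hm, SymplecticGroup.fromBlocks_mem_iff, transpose_nonsing_inv,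
    IsSymm, nonsing_inv_mul_cancel_left _ _ hw, mul_nonsing_inv_cancel_right _ _ hwt,
    nonsing_inv_mul _ hw, eq_comm]

open scoped Matrix.Norms.Operator in
theorem hasDerivAt_momentum (h : IsEnvelopePair κ R m w s) (t : ℝ) :
    HasDerivAt (fun r => w r * s r)
      (w t * (((w t)ᵀ * w t)⁻¹ * (m t)⁻¹ * ((w t)ᵀ * w t)⁻¹ - κ t - s t * (R t)ᵀ)) t := by
  refine (hasDerivAt_matrix_mul (h.hasDerivAt_fst t) (h.hasDerivAt_snd t)).congr_deriv ?_
  noncomm_ring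

open scoped Matrix.Norms.Operator in
theorem isEnvelopeSolution (hm : ∀ t, IsUnit (m t).det) (h : IsEnvelopePair κ R m w s) :
    IsEnvelopeSolution κ R m w := by
  have hmom : (fun r => deriv w r * m r - w r * R r * m r) = fun r => w r * s r :=
    funext (h.momentum_eq hm)
  refine ⟨h.isUnit_det, fun t => (h.hasDerivAt_fst t).differentiableAt,
    hmom ▸ fun t => (h.hasDerivAt_momentum t).differentiableAt, fun t => ?_⟩
  have hinv : ((w t)ᵀ * w t * m t * (w t)ᵀ)⁻¹ =
      w t * (((w t)ᵀ * w t)⁻¹ * (m t)⁻¹ * ((w t)ᵀ * w t)⁻¹) := by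
    simp only [Matrix.mul_inv_rev, mul_assoc, mul_nonsing_inv_cancel_left _ _ (h.isUnit_det t)]
  have hderiv : deriv w t * m t = w t * R t * m t + w t * s t := by
    rw [← h.momentum_eq hm]; abel
  rw [hmom, deriv_matrix_eq (h.hasDerivAt_momentum t), hderiv, hinv]
  noncomm_ring

end IsEnvelopePair

open scoped Matrix.Norms.Operator in
theorem IsEnvelopeSolution.exists_isEnvelopePair (hm : ∀ t, IsUnit (m t).det)
    (hw : IsEnvelopeSolution κ R m w) : ∃ s, IsEnvelopePair κ R m w s := by
  obtain ⟨hdet, hdiff, hdiffP, heq⟩ := hw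
  set P := fun r => deriv w r * m r - w r * R r * m r with hP
  have hw' (t : ℝ) : HasDerivAt w (w t * (R t + (w t)⁻¹ * P t * (m t)⁻¹)) t := by
    refine (hasDerivAt_matrix_deriv (hdiff t)).congr_deriv ?_
    simp only [hP, mul_add, mul_assoc, mul_nonsing_inv_cancel_left _ _ (hdet t), sub_mul,
      mul_nonsing_inv _ (hm t), mul_one, add_sub_cancel]
  have hP' (t : ℝ) : deriv P t = ((w t)ᵀ * w t * m t * (w t)ᵀ)⁻¹ - P t * (R t)ᵀ - w t * κ t := by
    rw [← sub_eq_zero, ← heq t]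
    simp only [hP]
    noncomm_ring
  refine ⟨fun t => (w t)⁻¹ * P t, hdet, hw', fun t => ?_⟩
  refine (hasDerivAt_matrix_mul (hasDerivAt_matrix_inv (hw' t) (hdet t))
    (hasDerivAt_matrix_deriv (hdiffP t))).congr_deriv ?_
  simp only [hP', Matrix.mul_inv_rev, nonsing_inv_mul_cancel_left _ _ (hdet t), mul_sub]
  noncomm_ring

end Envelope

section Generator

variable {n : ℕ} {κ R m : ℝ → Mat n}

/-- The coefficient matrix `J A(t)` of the Hamiltonian system. -/
noncomputable def hamGenerator (κ R m : ℝ → Mat n) (t : ℝ) :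
    Matrix (Fin n ⊕ Fin n) (Fin n ⊕ Fin n) ℝ :=
  stdJ n * hamMatrix (κ t) (R t) (m t)

theorem hamGenerator_eq_fromBlocks (κ R m : ℝ → Mat n) (t : ℝ) :
    hamGenerator κ R m t = fromBlocks (R t)ᵀ (m t)⁻¹ (-κ t) (-R t) := by
  simp [hamGenerator, stdJ, hamMatrix, fromBlocks_multiply]

theorem continuous_hamGenerator (hκ : Continuous κ) (hR : Continuous R) (hm : Continuous m)
    (hdet : ∀ t, IsUnit (m t).det) : Continuous (hamGenerator κ R m) := by
  rw [funext (hamGenerator_eq_fromBlocks κ R m)]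
  exact hR.matrix_transpose.matrix_fromBlocks (continuous_matrix_inv hm hdet) hκ.neg hR.neg

theorem periodic_hamGenerator {T : ℝ} (hκ : Function.Periodic κ T) (hR : Function.Periodic R T)
    (hm : Function.Periodic m T) : Function.Periodic (hamGenerator κ R m) T := fun t => by
  simp only [hamGenerator, hκ t, hR t, hm t]

theorem hamGenerator_mul_J_add (hκ : ∀ t, (κ t).IsSymm) (hm : ∀ t, (m t).IsSymm) (t : ℝ) :
    hamGenerator κ R m t * J (Fin n) ℝ + J (Fin n) ℝ * (hamGenerator κ R m t)ᵀ = 0 := by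
  simp [hamGenerator_eq_fromBlocks, J, fromBlocks_transpose, fromBlocks_multiply, fromBlocks_add,
    transpose_nonsing_inv, (hκ t).eq, (hm t).eq]

theorem injective_toBlocks₁₂_hamGenerator (hm : ∀ t, IsUnit (m t).det) (t : ℝ) :
    Function.Injective (hamGenerator κ R m t).toBlocks₁₂.mulVec := by
  rw [hamGenerator_eq_fromBlocks, toBlocks_fromBlocks₁₂]
  exact mulVec_injective_of_isUnit
    ((isUnit_iff_isUnit_det _).2 (isUnit_nonsing_inv_det _ (hm t)))

end Generator

section Covariance

variable {ι : Type*} [Fintype ι] [DecidableEq ι]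

/-- The general positive definite symplectic matrix, with parameters `a` positive definite and `s`
symmetric. It is `(Sᵀ S)⁻¹` for `S = [[(wᵀ)⁻¹, 0], [-w s, w]]` and any `w` with `wᵀ w = a`. -/
noncomputable def covariance (a s : Matrix ι ι ℝ) : Matrix (ι ⊕ ι) (ι ⊕ ι) ℝ :=
  fromBlocks a (a * s) (s * a) (a⁻¹ + s * a * s)

theorem exists_eq_covariance {F : Matrix (ι ⊕ ι) (ι ⊕ ι) ℝ} (hF : F.PosDef)
    (hFs : F ∈ symplecticGroup ι ℝ) : ∃ a s, a.PosDef ∧ s.IsSymm ∧ F = covariance a s := by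
  have ha : F.toBlocks₁₁.PosDef := hF.submatrix Sum.inl_injective
  obtain ⟨a, b, c, d, rfl⟩ : ∃ a b c d, F = fromBlocks a b c d :=
    ⟨_, _, _, _, (fromBlocks_toBlocks F).symm⟩
  rw [toBlocks_fromBlocks₁₁] at ha
  have hdet : IsUnit a.det := (isUnit_iff_isUnit_det _).1 ha.isUnit
  obtain ⟨haT, hbc, hcb, -⟩ := isHermitian_fromBlocks_iff.1 hF.isHermitian
  rw [IsHermitian] at haT
  obtain ⟨hac, -, had⟩ := SymplecticGroup.fromBlocks_mem_iff.1 hFs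
  simp only [conjTranspose_eq_transpose_of_trivial] at haT hbc hcb
  rw [haT, hcb] at hac had
  have hb : b = a * (a⁻¹ * b) := (mul_nonsing_inv_cancel_left _ _ hdet).symm
  have hs : c * a⁻¹ = a⁻¹ * b := by
    rw [← nonsing_inv_mul_cancel_left (B := c * a⁻¹) a hdet, ← mul_assoc a, hac,
      mul_nonsing_inv_cancel_right _ _ hdet]
  have hc : c = a⁻¹ * b * a := by rw [← hs, nonsing_inv_mul_cancel_right _ _ hdet]
  have hd : d = a⁻¹ + c * (a⁻¹ * b) := by
    rw [← mul_assoc, hs, ← nonsing_inv_mul_cancel_left (B := d) a hdet, sub_eq_iff_eq_add.1 had,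
      mul_add, mul_one, mul_assoc]
  refine ⟨a, a⁻¹ * b, ha, ?_, ?_⟩
  · rw [IsSymm, transpose_mul, transpose_nonsing_inv, haT, hbc, hs]
  · rw [covariance, ← hb, ← hc, ← hd]

theorem posDef_covariance {a s : Matrix ι ι ℝ} (ha : a.PosDef) (hs : s.IsSymm) :
    (covariance a s).PosDef := by
  have hdet : IsUnit a.det := (isUnit_iff_isUnit_det _).1 ha.isUnit
  let := a.invertibleOfIsUnitDet hdet
  have hsa : s * a = (a * s)ᴴ := by
    rw [conjTranspose_mul, ha.isHermitian.eq, conjTranspose_eq_transpose_of_trivial, hs.eq]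
  have hschur : a⁻¹ + (a * s)ᴴ * s - (a * s)ᴴ * a⁻¹ * (a * s) = a⁻¹ := by
    rw [← hsa, mul_nonsing_inv_cancel_right _ _ hdet, ← mul_assoc, add_sub_cancel_right]
  rw [covariance, hsa]
  refine (PosSemidef.posDef_iff_isUnit ?_).2 ((isUnit_iff_isUnit_det _).2 ?_)
  · rw [PosDef.fromBlocks₁₁ _ _ ha, hschur]
    exact ha.inv.posSemidef
  · rw [det_fromBlocks₁₁, invOf_eq_nonsing_inv, hschur]
    simpa using hdet

open scoped Matrix.Norms.Operator in
theorem hasDerivAt_covariance_iff {n : ℕ} {κ R m a s : ℝ → Mat n} (hκ : ∀ t, (κ t).IsSymm)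
    (hm : ∀ t, (m t).IsSymm) (ha : ∀ t, IsUnit (a t).det)
    (hs : ∀ t, (s t).IsSymm) (t : ℝ) :
    HasDerivAt (fun r => covariance (a r) (s r)) (hamGenerator κ R m t * covariance (a t) (s t)
        + covariance (a t) (s t) * (hamGenerator κ R m t)ᵀ) t ↔
      HasDerivAt a ((R t + s t * (m t)⁻¹)ᵀ * a t + a t * (R t + s t * (m t)⁻¹)) t ∧
      HasDerivAt s ((a t)⁻¹ * (m t)⁻¹ * (a t)⁻¹ - κ t - s t * (R t)ᵀ - R t * s t
        - s t * (m t)⁻¹ * s t) t := by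
  simp only [covariance, hamGenerator_eq_fromBlocks, fromBlocks_transpose, fromBlocks_multiply,
    fromBlocks_add, hasDerivAt_fromBlocks_iff, transpose_neg, transpose_transpose,
    transpose_nonsing_inv, transpose_add, transpose_mul, (hκ t).eq, (hm t).eq, (hs t).eq]
  have hinv : (a t)⁻¹ * a t = 1 := nonsing_inv_mul _ (ha t)
  have hinv' : a t * (a t)⁻¹ = 1 := mul_nonsing_inv _ (ha t)
  have hcancel (x : Mat n) : (a t)⁻¹ * (a t * x) = x := nonsing_inv_mul_cancel_left _ _ (ha t)
  have hcancel' (x : Mat n) : a t * ((a t)⁻¹ * x) = x := mul_nonsing_inv_cancel_left _ _ (ha t)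
  refine ⟨fun ⟨h₁, h₂, _, _⟩ => ⟨?_, ?_⟩, fun ⟨h₁, h₂⟩ => ⟨?_, ?_, ?_, ?_⟩⟩
  · convert h₁ using 1
    noncomm_ring
  · convert hasDerivAt_matrix_mul (hasDerivAt_matrix_inv h₁ (ha t)) h₂ using 1
    · simp only [nonsing_inv_mul_cancel_left _ _ (ha _)]
    · simp only [neg_mul, mul_add, add_mul, mul_assoc, hcancel]
      noncomm_ring
  · convert h₁ using 1
    noncomm_ring
  · convert hasDerivAt_matrix_mul h₁ h₂ using 1
    simp only [mul_sub, mul_assoc, hcancel']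
    noncomm_ring
  · convert hasDerivAt_matrix_mul h₂ h₁ using 1
    simp only [sub_mul, mul_assoc, hinv, mul_one]
    noncomm_ring
  · refine ((hasDerivAt_matrix_inv h₁ (ha t)).fun_add
      (hasDerivAt_matrix_mul (hasDerivAt_matrix_mul h₂ h₁) h₂)).congr_deriv ?_
    simp only [mul_sub, sub_mul, mul_add, add_mul, mul_assoc, hinv', hcancel, hcancel', mul_one]
    noncomm_ring

end Covariance

section Stability

variable {n : ℕ} {κ R m w s : ℝ → Mat n} {T : ℝ}

theorem periodic_matAbs_iff :
    Function.Periodic (fun t => matAbs (w t)) T ↔ Function.Periodic (fun t => (w t)ᵀ * w t) T := by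
  have hnonneg (t : ℝ) : 0 ≤ (w t)ᵀ * w t := by
    simpa using (posSemidef_conjTranspose_mul_self (w t)).nonneg
  refine forall_congr' fun t => ⟨fun (h : matAbs _ = matAbs _) => ?_, congrArg CFC.sqrt⟩
  calc (w (t + T))ᵀ * w (t + T) = matAbs (w (t + T)) * matAbs (w (t + T)) :=
        (CFC.sqrt_mul_sqrt_self _ (hnonneg _)).symm
    _ = (w t)ᵀ * w t := by rw [h, matAbs, CFC.sqrt_mul_sqrt_self _ (hnonneg _)]

namespace IsEnvelopePair

theorem hasDerivAt_transpose_mul_self (h : IsEnvelopePair κ R m w s) (t : ℝ) :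
    HasDerivAt (fun r => (w r)ᵀ * w r) ((R t + s t * (m t)⁻¹)ᵀ * ((w t)ᵀ * w t)
      + (w t)ᵀ * w t * (R t + s t * (m t)⁻¹)) t := by
  simpa only [transpose_mul, mul_assoc] using hasDerivAt_matrix_mul
    (hasDerivAt_matrix_transpose (h.hasDerivAt_fst t)) (h.hasDerivAt_fst t)

open scoped Matrix.Norms.Operator in
theorem isSymm (hR : Continuous R) (hm : Continuous m) (hκs : ∀ t, (κ t).IsSymm)
    (hms : ∀ t, (m t).IsSymm) (hdet : ∀ t, IsUnit (m t).det) (h : IsEnvelopePair κ R m w s)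
    (h₀ : (s 0).IsSymm) (t : ℝ) : (s t).IsSymm := by
  have hs : Continuous s := continuous_iff_continuousAt.2 fun t => (h.hasDerivAt_snd t).continuousAt
  have hm' : Continuous fun t => (m t)⁻¹ := continuous_matrix_inv hm hdet
  -- The Riccati equation is invariant under transposition, so the difference of the solutions
  -- `sᵀ` and `s` satisfies a linear equation.
  have hskew (t : ℝ) : HasDerivAt (fun r => (s r)ᵀ - s r)
      (-(R t + (s t)ᵀ * (m t)⁻¹) * ((s t)ᵀ - s t)
        + ((s t)ᵀ - s t) * -((R t)ᵀ + (m t)⁻¹ * s t)) t := by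
    refine ((hasDerivAt_matrix_transpose (h.hasDerivAt_snd t)).fun_sub
      (h.hasDerivAt_snd t)).congr_deriv ?_
    simp only [transpose_sub, transpose_mul, transpose_nonsing_inv, transpose_transpose,
      (hκs t).eq, (hms t).eq]
    noncomm_ring
  refine sub_eq_zero.1 (congrFun (eq_of_hasDerivAt_matrix_mul_add_mul (by fun_prop)
    (by fun_prop) hskew (Y := 0) (fun t => ?_) (t₀ := 0) (sub_eq_zero.2 h₀)) t)
  simp only [Pi.zero_apply, mul_zero, zero_mul, add_zero]
  exact hasDerivAt_const t (0 : Mat n)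

end IsEnvelopePair

open scoped Matrix.Norms.Operator in
theorem exists_isEnvelopePair_of_isStable (hT : 0 ≤ T) (hκ : Continuous κ) (hR : Continuous R)
    (hm : Continuous m) (hκT : Function.Periodic κ T) (hRT : Function.Periodic R T)
    (hmT : Function.Periodic m T) (hκs : ∀ t, (κ t).IsSymm) (hms : ∀ t, (m t).IsSymm)
    (hdet : ∀ t, IsUnit (m t).det) (hst : IsStable κ R m) :
    ∃ w s, IsEnvelopePair κ R m w s ∧ (∀ t, (s t).IsSymm) ∧
      Function.Periodic (fun t => (w t)ᵀ * w t) T := by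
  obtain ⟨F, hFT, hF, hFs, hF'⟩ := exists_periodic_posDef_of_bounded hT
    (continuous_hamGenerator hκ hR hm hdet) (periodic_hamGenerator hκT hRT hmT)
    (hamGenerator_mul_J_add hκs hms) hst
  choose a s ha hs hFas using fun t => exists_eq_covariance (hF t) (hFs t)
  obtain rfl : F = fun t => covariance (a t) (s t) := funext hFas
  have hadet (t : ℝ) : IsUnit (a t).det := (isUnit_iff_isUnit_det _).1 (ha t).isUnit
  have has' (t : ℝ) := (hasDerivAt_covariance_iff hκs hms hadet hs t).1 (hF' t)
  have hL : Continuous fun t => R t + s t * (m t)⁻¹ := hR.add <|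
    (continuous_iff_continuousAt.2 fun t => (has' t).2.continuousAt).mul
      (continuous_matrix_inv hm hdet)
  obtain ⟨w, hw, hwa⟩ := exists_transpose_mul_self_eq hL (ha 0).posSemidef fun t => (has' t).1
  refine ⟨w, s, ⟨fun t => ?_, hw, fun t => ?_⟩, hs, fun t => ?_⟩
  · refine isUnit_of_mul_isUnit_right (x := ((w t)ᵀ).det) ?_
    rw [← det_mul, hwa]
    exact hadet t
  · rw [hwa]
    exact (has' t).2
  · simp only [hwa]
    exact congrArg toBlocks₁₁ (hFT t)

open scoped Matrix.Norms.Elementwise in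
theorem IsEnvelopePair.isStable (hT : 0 < T) (hκ : Continuous κ) (hR : Continuous R)
    (hm : Continuous m) (hκT : Function.Periodic κ T) (hRT : Function.Periodic R T)
    (hmT : Function.Periodic m T) (hκs : ∀ t, (κ t).IsSymm) (hms : ∀ t, (m t).IsSymm)
    (hdet : ∀ t, IsUnit (m t).det) (h : IsEnvelopePair κ R m w s) (hs : ∀ t, (s t).IsSymm)
    (hper : Function.Periodic (fun t => (w t)ᵀ * w t) T) : IsStable κ R m := by
  intro z hz
  have hB := continuous_hamGenerator hκ hR hm hdet
  have hpos (t : ℝ) : ((w t)ᵀ * w t).PosDef := by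
    simpa using PosDef.conjTranspose_mul_self (w t)
      (mulVec_injective_of_isUnit ((isUnit_iff_isUnit_det _).2 (h.isUnit_det t)))
  have hcov (t : ℝ) := (hasDerivAt_covariance_iff hκs hms
    (fun r => (isUnit_iff_isUnit_det _).1 (hpos r).isUnit) hs t).2
    ⟨h.hasDerivAt_transpose_mul_self t, h.hasDerivAt_snd t⟩
  obtain ⟨C, hC₀, hC⟩ := exists_sq_apply_le_mul hB (posDef_covariance (hpos 0) (hs 0)) hcov hz
  have hcont : Continuous fun t => (w t)ᵀ * w t :=
    continuous_iff_continuousAt.2 fun t => (h.hasDerivAt_transpose_mul_self t).continuousAt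
  obtain ⟨K, hK⟩ := (hper.isBounded_of_continuous hT.ne' hcont).exists_norm_le
  have hx (t : ℝ) : ‖z t ∘ Sum.inl‖ ≤ √(C * K) := by
    refine (pi_norm_le_iff_of_nonneg (Real.sqrt_nonneg _)).2 fun i =>
      Real.abs_le_sqrt ((hC t (Sum.inl i)).trans ?_)
    gcongr
    calc ((w t)ᵀ * w t) i i ≤ ‖(w t)ᵀ * w t‖ :=
          (Real.le_norm_self _).trans (norm_entry_le_entrywise_sup_norm _)
      _ ≤ K := hK _ ⟨t, rfl⟩
  obtain ⟨C', hC'⟩ := exists_norm_le_of_norm_comp_inl_le hT hB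
    (periodic_hamGenerator hκT hRT hmT) (injective_toBlocks₁₂_hamGenerator hdet) hz hx
  exact ⟨C', fun t _ => hC' t⟩

end Stability

end LinHam

theorem theorem2 (n : ℕ) (T : ℝ) (hT : 0 < T) (κ R m : ℝ → LinHam.Mat n)
    (hκc : Continuous κ) (hRc : Continuous R) (hmc : Continuous m)
    (hκT : Function.Periodic κ T) (hRT : Function.Periodic R T) (hmT : Function.Periodic m T)
    (hκs : ∀ t, (κ t).IsSymm) (hms : ∀ t, (m t).IsSymm) (hm : ∀ t, IsUnit (m t).det) :
    LinHam.IsStable κ R m ↔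
      ∃ w : ℝ → LinHam.Mat n,
        LinHam.IsEnvelopeSolution κ R m w ∧
        LinHam.envelopeS R m w 0 ∈ Matrix.symplecticGroup (Fin n) ℝ ∧
        Function.Periodic (fun t => LinHam.matAbs (w t)) T := by
  constructor
  · intro hst
    obtain ⟨w, s, h, hs, hper⟩ := LinHam.exists_isEnvelopePair_of_isStable hT.le hκc hRc hmc
      hκT hRT hmT hκs hms hm hst
    exact ⟨w, h.isEnvelopeSolution hm, (h.envelopeS_mem_symplecticGroup_iff hm 0).2 (hs 0),
      LinHam.periodic_matAbs_iff.2 hper⟩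
  · rintro ⟨w, hw, hS, hper⟩
    obtain ⟨s, h⟩ := hw.exists_isEnvelopePair hm
    have hs := h.isSymm hRc hmc hκs hms hm ((h.envelopeS_mem_symplecticGroup_iff hm 0).1 hS)
    exact h.isStable hT hκc hRc hmc hκT hRT hmT hκs hms hm hs
      (LinHam.periodic_matAbs_iff.1 hper)
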